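/- Let $X$ be a real random variable whose distribution $F$ is absolutely continuous with density $f$. Suppose that $f$ is symmetric, $f(-x)=f(x)$ for all $x\in\mathbb R$, and that for some $x_0>1$ it is continuous and strictly positive on $\{x:|x|\ge x_0\}$. Suppose further that $$\int_{|x|\ge x_0}\frac{-\ln f(x)}{x^2\ln|x|}\,dx=\infty$$ and that the function $x\mapsto \dfrac{-\ln f(x)}{\ln x}$ is nondecreasing on $[x_0,\infty)$ and tends to $\infty$ as $x\to\infty$. Then all moments $m_k=\mathbf E[X^k]$ are finite and: 1. $X$ satisfies Carleman's condition $\sum_{k=1}^{\infty} (m_{2k})^{-1/(2k)}=\infty$; 2. $X$ is moment-determinate: $F$ is the only probability distribution on $\mathbb R$ with all moments finite and equal to $m_1,m_2,\ldots$; 3. $X^2$ is moment-determinate on $\mathbb R_+=[0,\infty)$: its distribution is the only probability distribution on $[0,\infty)$ with all moments finite and equal to $\mathbf E[X^{2k}]$, $k=1,2,\ldots$. -/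

import Mathlib

open MeasureTheory
open scoped ENNReal

namespace MomentProblem

/-- All moments of the measure `μ` on `ℝ` are finite. -/
def FiniteMoments (μ : Measure ℝ) : Prop :=
  ∀ k : ℕ, Integrable (fun x : ℝ => x ^ k) μ

/-- Carleman's condition (Hamburger case): all moments `m_k` of `μ` are finite and
`∑_{k ≥ 1} (m_{2k})^{-1/(2k)} = ∞`. The summation index is shifted by one, and the series is a
series in `[0, ∞]`, where `0 ^ (-1/(2k)) = ∞`. -/
def Carleman (μ : Measure ℝ) : Prop :=
  FiniteMoments μ ∧
    ∑' k : ℕ, ENNReal.ofReal (∫ x, x ^ (2 * (k + 1)) ∂μ) ^ (-1 / (2 * ((k : ℝ) + 1))) = ∞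

/-- `μ` is concentrated on `S`, has finite moments, and is the only probability measure
concentrated on `S` with its moments. -/
def MDeterminateOn (S : Set ℝ) (μ : Measure ℝ) : Prop :=
  μ Sᶜ = 0 ∧ FiniteMoments μ ∧
    ∀ ν : Measure ℝ, IsProbabilityMeasure ν → ν Sᶜ = 0 → FiniteMoments ν →
      (∀ k : ℕ, ∫ x, x ^ k ∂ν = ∫ x, x ^ k ∂μ) → ν = μ

/-- The integral of `g` over `s` exists in the extended sense and equals `+∞`: the positive part
has infinite integral, the negative part a finite one. -/
def IntegralEqTop (g : ℝ → ℝ) (s : Set ℝ) : Prop :=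
  ∫⁻ x in s, ENNReal.ofReal (g x) = ∞ ∧ ∫⁻ x in s, ENNReal.ofReal (-g x) < ∞

end MomentProblem

/-!
Write `f x = x ^ (-H x)` with `H` nondecreasing. If `b n` is the point where `H` reaches `2 n + 2`,
then `x ^ (2 n) f x ≤ x⁻²` beyond `b n`, so the moment of order `2 n` is at most `3 (b n) ^ (2 n)`.
By the layer-cake formula for the measure `x⁻² dx`, which gives mass `1 / b` to `[b, ∞)`, the
divergence of `∫ H x / x² dx` forces `∑ 1 / b n = ∞`, and Carleman's condition follows.

If a second law has the same moments, the difference of the two characteristic functions is flat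
at `0`, and its derivatives are bounded by the absolute moments of the sum of the two laws, a
log-convex sequence `M`. Carleman's inequality turns Carleman's condition into
`∑ M n / M (n + 1) = ∞`, and the Denjoy–Carleman theorem shows that the difference vanishes.

A law `ν` on the half-line is recovered, by squaring, from the symmetrized law of the square root
of a variable with law `ν`; this reduces the claim about `X²` to the claim about `X`.
-/

namespace MomentProblem

open Set Filter Finset Real
open scoped Topology

section DenjoyCarleman

open scoped ContDiff

/-- Positive logarithmically convex sequences: the weights defining a Denjoy–Carleman class. -/
structure PosLogConvex (M : ℕ → ℝ) : Prop where
  pos : ∀ n, 0 < M n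
  sq_le : ∀ n, M (n + 1) ^ 2 ≤ M n * M (n + 2)

theorem PosLogConvex.monotone_ratio {M : ℕ → ℝ} (hM : PosLogConvex M) :
    Monotone fun n => M (n + 1) / M n :=
  monotone_nat_of_le_succ fun n => by
    rw [div_le_div_iff₀ (hM.pos n) (hM.pos (n + 1))]
    linarith [hM.sq_le n]

theorem PosLogConvex.succ_le_ratio_mul {M : ℕ → ℝ} (hM : PosLogConvex M) {n N : ℕ} (hn : n ≤ N) :
    M (n + 1) ≤ M (N + 1) / M N * M n :=
  (div_le_iff₀ (hM.pos n)).1 (hM.monotone_ratio hn)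

variable {E : Type*} [NormedAddCommGroup E] [NormedSpace ℝ E] {f : ℝ → E} {M : ℕ → ℝ}

theorem hasDerivAt_iteratedDeriv (hf : ContDiff ℝ ∞ f) (n : ℕ) (x : ℝ) :
    HasDerivAt (iteratedDeriv n f) (iteratedDeriv (n + 1) f x) x := by
  rw [iteratedDeriv_succ]
  exact (hf.differentiable_iteratedDeriv n (mod_cast ENat.natCast_lt_top n) x).hasDerivAt

/-- Downward induction on `n` applies: by log-convexity, the bound for the derivative of order
`n + 1` is at most the derivative of the bound for the derivative of order `n`. -/
theorem norm_iteratedDeriv_le_exp_mul (hf : ContDiff ℝ ∞ f) (hM : PosLogConvex M)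
    (hfM : ∀ n x, ‖iteratedDeriv n f x‖ ≤ M n) {N : ℕ} {a : ℝ}
    (ha : ∀ n, ‖iteratedDeriv n f a‖ ≤ exp (n - (N + 1)) * M n) {n : ℕ} (hn : n ≤ N + 1) :
    ∀ x, a ≤ x → ‖iteratedDeriv n f x‖ ≤
      exp (n - (N + 1)) * M n * exp (exp 1 * (M (N + 1) / M N) * (x - a)) := by
  set r := M (N + 1) / M N
  have hr : 0 < r := div_pos (hM.pos _) (hM.pos _)
  induction hn using Nat.decreasingInduction with
  | self =>
    intro x hx
    have hexp : 1 ≤ exp (exp 1 * r * (x - a)) :=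
      one_le_exp (mul_nonneg (by positivity) (sub_nonneg.2 hx))
    calc ‖iteratedDeriv (N + 1) f x‖ ≤ M (N + 1) := hfM _ x
      _ ≤ M (N + 1) * exp (exp 1 * r * (x - a)) := le_mul_of_one_le_right (hM.pos _).le hexp
      _ = _ := by simp
  | of_succ n hn ih =>
    intro x hx
    have hbound (t : ℝ) : HasDerivAt (fun t => exp (n - (N + 1)) * M n * exp (exp 1 * r * (t - a)))
        (exp (n - (N + 1)) * M n * (exp (exp 1 * r * (t - a)) * (exp 1 * r))) t := by
      simpa using ((((hasDerivAt_id t).sub_const a).const_mul (exp 1 * r)).exp).const_mul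
        (exp (n - (N + 1)) * M n)
    refine image_norm_le_of_norm_deriv_right_le_deriv_boundary (a := a) (b := x)
      (fun t _ => (hasDerivAt_iteratedDeriv hf n t).continuousAt.continuousWithinAt)
      (fun t _ => (hasDerivAt_iteratedDeriv hf n t).hasDerivWithinAt) (by simpa using ha n)
      hbound (fun t ht => ?_) (Set.right_mem_Icc.2 hx)
    calc ‖iteratedDeriv (n + 1) f t‖
        ≤ exp ((n + 1 : ℕ) - (N + 1)) * M (n + 1) * exp (exp 1 * r * (t - a)) := ih t ht.1
      _ ≤ exp ((n + 1 : ℕ) - (N + 1)) * (r * M n) * exp (exp 1 * r * (t - a)) := by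
          gcongr
          exact hM.succ_le_ratio_mul (Nat.le_of_lt_succ hn)
      _ = exp (n - (N + 1)) * M n * (exp (exp 1 * r * (t - a)) * (exp 1 * r)) := by
          rw [show (((n + 1 : ℕ) : ℝ) - (N + 1)) = (n - (N + 1)) + 1 by push_cast; ring, exp_add]
          ring

/-- Bang's estimate: a step of length `M N / (e M (N + 1))` costs at most a factor `e`. -/
theorem norm_iteratedDeriv_le_of_sub_le (hf : ContDiff ℝ ∞ f) (hM : PosLogConvex M)
    (hfM : ∀ n x, ‖iteratedDeriv n f x‖ ≤ M n) {N : ℕ} {a x : ℝ} (hax : a ≤ x)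
    (hx : x - a ≤ exp (-1) * (M N / M (N + 1)))
    (ha : ∀ n, ‖iteratedDeriv n f a‖ ≤ exp (n - (N + 1)) * M n) (n : ℕ) :
    ‖iteratedDeriv n f x‖ ≤ exp (n - N) * M n := by
  rcases le_total N n with hn | hn
  · exact (hfM n x).trans (le_mul_of_one_le_left (hM.pos n).le (one_le_exp (by simpa using hn)))
  have hstep : exp 1 * (M (N + 1) / M N) * (x - a) ≤ 1 := by
    have hN := hM.pos N
    have hN' := hM.pos (N + 1)
    calc exp 1 * (M (N + 1) / M N) * (x - a)
        ≤ exp 1 * (M (N + 1) / M N) * (exp (-1) * (M N / M (N + 1))) := by gcongr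
      _ = 1 := by
        rw [exp_neg]
        field_simp
  calc ‖iteratedDeriv n f x‖
      ≤ exp (n - (N + 1)) * M n * exp (exp 1 * (M (N + 1) / M N) * (x - a)) :=
        norm_iteratedDeriv_le_exp_mul hf hM hfM ha (by omega) x hax
    _ ≤ exp (n - (N + 1)) * M n * exp 1 := by
        have hn := hM.pos n
        gcongr
    _ = exp (n - N) * M n := by
        rw [mul_right_comm, ← exp_add, sub_add_eq_sub_sub, sub_add_cancel]

theorem norm_iteratedDeriv_le_of_sub_le_sum (hf : ContDiff ℝ ∞ f) (hM : PosLogConvex M)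
    (hfM : ∀ n x, ‖iteratedDeriv n f x‖ ≤ M n) {a : ℝ} (ha : ∀ n, iteratedDeriv n f a = 0)
    (i N : ℕ) {x : ℝ} (hax : a ≤ x)
    (hx : x - a ≤ ∑ j ∈ range i, exp (-1) * (M (j + N) / M (j + N + 1))) (n : ℕ) :
    ‖iteratedDeriv n f x‖ ≤ exp (n - N) * M n := by
  induction i generalizing N x n with
  | zero =>
    obtain rfl : x = a := le_antisymm (by simpa using hx) hax
    rw [ha, norm_zero]
    exact mul_nonneg (exp_pos _).le (hM.pos n).le
  | succ i ih =>
    have hterm (k : ℕ) : 0 ≤ exp (-1) * (M k / M (k + 1)) :=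
      mul_nonneg (exp_pos _).le (div_nonneg (hM.pos _).le (hM.pos _).le)
    set s := ∑ j ∈ range i, exp (-1) * (M (j + (N + 1)) / M (j + (N + 1) + 1))
    have hs : 0 ≤ s := Finset.sum_nonneg fun j _ => hterm _
    have hxs : x - a ≤ s + exp (-1) * (M N / M (N + 1)) := by
      rw [Finset.sum_range_succ'] at hx
      simpa [s, add_assoc, add_comm 1] using hx
    -- `y` is where the last of the `i + 1` steps starts.
    set y := min x (a + s)
    have hay : a ≤ y := le_min hax (by linarith)
    have hya : y - a ≤ s := by linarith [min_le_right x (a + s)]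
    refine norm_iteratedDeriv_le_of_sub_le hf hM hfM (min_le_left x (a + s)) ?_
      (fun n => by simpa using ih (N + 1) hay hya n) n
    rw [sub_le_iff_le_add', ← min_add_add_right]
    exact le_min (by linarith [hterm N]) (by linarith)

theorem eq_zero_of_iteratedDeriv_eq_zero_of_le (hf : ContDiff ℝ ∞ f) (hM : PosLogConvex M)
    (hdiv : ¬ Summable fun n => M n / M (n + 1)) (hfM : ∀ n x, ‖iteratedDeriv n f x‖ ≤ M n)
    {a : ℝ} (ha : ∀ n, iteratedDeriv n f a = 0) {x : ℝ} (hx : a ≤ x) : f x = 0 := by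
  have hbound (N : ℕ) : ‖f x‖ ≤ exp (-N) * M 0 := by
    have hnonneg (j : ℕ) : 0 ≤ exp (-1) * (M (j + N) / M (j + N + 1)) :=
      mul_nonneg (exp_pos _).le (div_nonneg (hM.pos _).le (hM.pos _).le)
    have hdivN : ¬ Summable fun j => exp (-1) * (M (j + N) / M (j + N + 1)) := by
      rwa [summable_mul_left_iff (exp_pos _).ne',
        summable_nat_add_iff (f := fun n => M n / M (n + 1)) N]
    obtain ⟨i, hi⟩ := (((not_summable_iff_tendsto_nat_atTop_of_nonneg hnonneg).1
      hdivN).eventually_ge_atTop (x - a)).exists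
    simpa using norm_iteratedDeriv_le_of_sub_le_sum hf hM hfM ha i N hx hi 0
  have hlim : Tendsto (fun N : ℕ => exp (-N) * M 0) atTop (𝓝 0) := by
    simpa using (tendsto_exp_neg_atTop_nhds_zero.comp
      (tendsto_natCast_atTop_atTop (R := ℝ))).mul_const (M 0)
  exact norm_le_zero_iff.1 (ge_of_tendsto' hlim hbound)

/-- The **Denjoy–Carleman theorem**. -/
theorem eq_zero_of_iteratedDeriv_eq_zero (hf : ContDiff ℝ ∞ f) (hM : PosLogConvex M)
    (hdiv : ¬ Summable fun n => M n / M (n + 1)) (hfM : ∀ n x, ‖iteratedDeriv n f x‖ ≤ M n)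
    {a : ℝ} (ha : ∀ n, iteratedDeriv n f a = 0) : f = 0 := by
  funext x
  rcases le_total a x with hx | hx
  · exact eq_zero_of_iteratedDeriv_eq_zero_of_le hf hM hdiv hfM ha hx
  · have hreflect := eq_zero_of_iteratedDeriv_eq_zero_of_le (f := fun t => f (-t)) (a := -a)
      (hf.comp contDiff_neg) hM hdiv
      (fun n t => by simpa [iteratedDeriv_comp_neg, norm_smul] using hfM n (-t))
      (fun n => by simp [iteratedDeriv_comp_neg, ha]) (neg_le_neg hx)
    simpa using hreflect

end DenjoyCarleman

section CarlemanInequality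

theorem succ_pow_le_exp_mul_factorial (n : ℕ) :
    ((n : ℝ) + 1) ^ n ≤ exp n * (n.factorial : ℝ) := by
  induction n with
  | zero => simp
  | succ n ih =>
    have hsucc : (n : ℝ) + 1 + 1 = (n + 1) * (1 + ((n + 1 : ℕ) : ℝ)⁻¹) := by
      push_cast
      field_simp
    push_cast at ih ⊢
    calc ((n : ℝ) + 1 + 1) ^ (n + 1)
        = (n + 1) * (n + 1) ^ n * (1 + ((n + 1 : ℕ) : ℝ)⁻¹) ^ (n + 1) := by
          rw [hsucc, mul_pow, pow_succ' ((n : ℝ) + 1) n]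
      _ ≤ (n + 1) * (exp n * n.factorial) * exp 1 := by
          gcongr
          exact one_add_inv_pow_le_exp
      _ = exp (n + 1) * ((n + 1).factorial : ℝ) := by
          rw [exp_add, Nat.factorial_succ]
          push_cast
          ring

theorem add_two_le_exp_one_mul_factorial_rpow (n : ℕ) :
    (n : ℝ) + 2 ≤ exp 1 * ((n + 1).factorial : ℝ) ^ ((n : ℝ) + 1)⁻¹ := by
  have hn : (0 : ℝ) < n + 1 := by positivity
  have hpow : ((n : ℝ) + 2) ^ ((n : ℝ) + 1) ≤ exp (n + 1) * ((n + 1).factorial : ℝ) := by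
    have := succ_pow_le_exp_mul_factorial (n + 1)
    rw [← rpow_natCast] at this
    push_cast at this ⊢
    rwa [add_assoc, one_add_one_eq_two] at this
  calc (n : ℝ) + 2 = (((n : ℝ) + 2) ^ ((n : ℝ) + 1)) ^ ((n : ℝ) + 1)⁻¹ := by
        rw [rpow_rpow_inv (by positivity) hn.ne']
    _ ≤ (exp (n + 1) * ((n + 1).factorial : ℝ)) ^ ((n : ℝ) + 1)⁻¹ := by gcongr
    _ = exp 1 * ((n + 1).factorial : ℝ) ^ ((n : ℝ) + 1)⁻¹ := by
        rw [mul_rpow (exp_pos _).le (by positivity), ← exp_mul, mul_inv_cancel₀ hn.ne']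

theorem sum_weighted_mean_eq (a : ℕ → ℝ) (N : ℕ) :
    ∑ n ∈ range N, (∑ j ∈ range (n + 1), ((j : ℝ) + 1) * a j) / (((n : ℝ) + 1) * (n + 2)) =
      ∑ j ∈ range N, a j - (∑ j ∈ range N, ((j : ℝ) + 1) * a j) / (N + 1) := by
  induction N with
  | zero => simp
  | succ N ih =>
    rw [Finset.sum_range_succ, ih, Finset.sum_range_succ a, Finset.sum_range_succ _ N]
    push_cast
    field_simp
    ring

variable {a : ℕ → ℝ}

/-- The weights `j + 1` make these bounds telescope when they are summed over `n`. -/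
theorem geom_mean_le_weighted_mean (ha : ∀ n, 0 ≤ a n) (n : ℕ) :
    (∏ j ∈ range (n + 1), a j) ^ ((n : ℝ) + 1)⁻¹ ≤
      exp 1 * ((∑ j ∈ range (n + 1), ((j : ℝ) + 1) * a j) / (((n : ℝ) + 1) * (n + 2))) := by
  set G := (∏ j ∈ range (n + 1), a j) ^ ((n : ℝ) + 1)⁻¹
  set S := ∑ j ∈ range (n + 1), ((j : ℝ) + 1) * a j
  have hprod : 0 ≤ ∏ j ∈ range (n + 1), a j := Finset.prod_nonneg fun j _ => ha j
  have hamgm : ((n + 1).factorial : ℝ) ^ ((n : ℝ) + 1)⁻¹ * G ≤ S / (n + 1) := by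
    have hfact : ∏ j ∈ range (n + 1), ((j : ℝ) + 1) = ((n + 1).factorial : ℝ) :=
      mod_cast Finset.prod_range_add_one_eq_factorial (n + 1)
    rw [← mul_rpow (by positivity) hprod, ← hfact, ← Finset.prod_mul_distrib]
    simpa using geom_mean_le_arith_mean (range (n + 1)) (fun _ => 1)
      (fun j => ((j : ℝ) + 1) * a j) (by simp)
      (by simpa using n.cast_add_one_pos)
      (fun j _ => mul_nonneg (by positivity) (ha j))
  have hmul : (n + 2) * G ≤ exp 1 * (S / (n + 1)) :=
    calc (n + 2) * G ≤ exp 1 * ((n + 1).factorial : ℝ) ^ ((n : ℝ) + 1)⁻¹ * G := by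
          gcongr
          exact add_two_le_exp_one_mul_factorial_rpow n
      _ ≤ exp 1 * (S / (n + 1)) := by
          rw [mul_assoc]
          gcongr
  rw [← div_div, ← mul_div_assoc, le_div_iff₀' (by positivity)]
  exact hmul

/-- **Carleman's inequality**. -/
theorem sum_geom_mean_le (ha : ∀ n, 0 ≤ a n) (N : ℕ) :
    ∑ n ∈ range N, (∏ j ∈ range (n + 1), a j) ^ ((n : ℝ) + 1)⁻¹ ≤
      exp 1 * ∑ n ∈ range N, a n := by
  refine (Finset.sum_le_sum fun n _ => geom_mean_le_weighted_mean ha n).trans ?_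
  rw [← Finset.mul_sum, sum_weighted_mean_eq]
  gcongr
  exact sub_le_self _ (div_nonneg (Finset.sum_nonneg fun j _ => mul_nonneg (by positivity) (ha j))
    (by positivity))

theorem summable_geom_mean (ha : ∀ n, 0 ≤ a n) (hsum : Summable a) :
    Summable fun n : ℕ => (∏ j ∈ range (n + 1), a j) ^ ((n : ℝ) + 1)⁻¹ :=
  summable_of_sum_range_le (fun _ => rpow_nonneg (Finset.prod_nonneg fun j _ => ha j) _)
    fun N => (sum_geom_mean_le ha N).trans
      (mul_le_mul_of_nonneg_left (hsum.sum_le_tsum _ fun j _ => ha j) (exp_pos 1).le)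

theorem prod_range_div_succ {M : ℕ → ℝ} (hM : ∀ n, 0 < M n) (n : ℕ) :
    ∏ j ∈ range n, M j / M (j + 1) = M 0 / M n := by
  induction n with
  | zero => simp [(hM 0).ne']
  | succ n ih => rw [Finset.prod_range_succ, ih, div_mul_div_cancel₀ (hM n).ne']

theorem not_summable_ratio {M : ℕ → ℝ} (hM : ∀ n, 0 < M n)
    (h : ∑' k : ℕ, ENNReal.ofReal (M (2 * (k + 1)) / M 0) ^ (-1 / (2 * ((k : ℝ) + 1))) = ∞) :
    ¬ Summable fun n => M n / M (n + 1) := by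
  intro hsum
  have hgeom := (summable_geom_mean (fun n => div_nonneg (hM n).le (hM (n + 1)).le)
    hsum).comp_injective (i := fun k : ℕ => 2 * k + 1) fun a b hab => by simpa using hab
  have hterm (k : ℕ) : ENNReal.ofReal (M (2 * (k + 1)) / M 0) ^ (-1 / (2 * ((k : ℝ) + 1))) =
      ENNReal.ofReal
        ((∏ j ∈ range (2 * k + 1 + 1), M j / M (j + 1)) ^ (((2 * k + 1 : ℕ) : ℝ) + 1)⁻¹) := by
    have hpos : 0 < M (2 * (k + 1)) / M 0 := div_pos (hM _) (hM 0)
    rw [prod_range_div_succ hM, ENNReal.ofReal_rpow_of_pos hpos, ← inv_div (M (2 * k + 1 + 1)),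
      inv_rpow (by exact hpos.le), ← rpow_neg (by exact hpos.le)]
    congr 2
    push_cast
    ring
  simp only [hterm] at h
  exact hgeom.tsum_ofReal_ne_top h

end CarlemanInequality

section Hamburger

open scoped ContDiff

variable {μ ν : Measure ℝ}

theorem FiniteMoments.integrable_abs_pow (hμ : FiniteMoments μ) (k : ℕ) :
    Integrable (fun x : ℝ => |x| ^ k) μ := by
  simpa only [abs_pow] using (hμ k).abs

theorem FiniteMoments.memLp_id (hμ : FiniteMoments μ) (k : ℕ) : MemLp id (k : ℝ≥0∞) μ := by
  rcases eq_or_ne k 0 with rfl | hk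
  · simpa using aestronglyMeasurable_id
  · refine (integrable_norm_rpow_iff (f := (id : ℝ → ℝ)) aestronglyMeasurable_id (mod_cast hk)
      (ENNReal.natCast_ne_top k)).1 ?_
    simpa using hμ.integrable_abs_pow k

theorem FiniteMoments.add (hμ : FiniteMoments μ) (hν : FiniteMoments ν) :
    FiniteMoments (μ + ν) :=
  fun k => (hμ k).add_measure (hν k)

theorem FiniteMoments.integral_abs_pow_add_measure (hμ : FiniteMoments μ) (hν : FiniteMoments ν)
    (n : ℕ) : ∫ x, |x| ^ n ∂(μ + ν) = ∫ x, |x| ^ n ∂μ + ∫ x, |x| ^ n ∂ν :=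
  integral_add_measure (hμ.integrable_abs_pow n) (hν.integrable_abs_pow n)

theorem FiniteMoments.integral_abs_pow_succ_sq_le (hμ : FiniteMoments μ) (n : ℕ) :
    (∫ x, |x| ^ (n + 1) ∂μ) ^ 2 ≤ (∫ x, |x| ^ n ∂μ) * ∫ x, |x| ^ (n + 2) ∂μ := by
  have hquad (t : ℝ) : 0 ≤ (∫ x, |x| ^ n ∂μ) * (t * t) + -(2 * ∫ x, |x| ^ (n + 1) ∂μ) * t +
      ∫ x, |x| ^ (n + 2) ∂μ := by
    have hint (k : ℕ) (c : ℝ) := (hμ.integrable_abs_pow k).mul_const c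
    calc 0 ≤ ∫ x, |x| ^ n * (t - |x|) ^ 2 ∂μ := integral_nonneg fun x => by positivity
      _ = ∫ x, (|x| ^ n * (t * t) - |x| ^ (n + 1) * (2 * t) + |x| ^ (n + 2)) ∂μ := by
          congr with x
          ring
      _ = _ := by
          rw [integral_add (by exact (hint n _).sub (hint (n + 1) _))
            (hμ.integrable_abs_pow (n + 2)), integral_sub (hint n _) (hint (n + 1) _),
            integral_mul_const, integral_mul_const]
          ring
  have hdiscrim := discrim_le_zero hquad
  rw [discrim] at hdiscrim
  linarith

theorem integral_sq_eq_zero_iff (hμ : Integrable (fun x : ℝ => x ^ 2) μ) :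
    ∫ x, x ^ 2 ∂μ = 0 ↔ ∀ᵐ x ∂μ, x = 0 := by
  rw [integral_eq_zero_iff_of_nonneg (fun x => sq_nonneg x) hμ]
  simp only [Filter.EventuallyEq, Pi.zero_apply, pow_eq_zero_iff two_ne_zero]

theorem FiniteMoments.posLogConvex_integral_abs_pow (hμ : FiniteMoments μ)
    (hdeg : ∫ x, x ^ 2 ∂μ ≠ 0) : PosLogConvex fun n => ∫ x, |x| ^ n ∂μ where
  pos n := by
    refine (integral_nonneg fun x => by positivity).lt_of_ne' fun h => hdeg ?_
    rw [integral_eq_zero_iff_of_nonneg (fun x => by positivity) (hμ.integrable_abs_pow n)] at h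
    rw [integral_sq_eq_zero_iff (hμ 2)]
    filter_upwards [h] with x hx
    exact abs_eq_zero.1 (eq_zero_of_pow_eq_zero hx)
  sq_le := hμ.integral_abs_pow_succ_sq_le

theorem eq_dirac_zero_of_integral_sq_eq_zero [IsProbabilityMeasure μ]
    (hμ : Integrable (fun x : ℝ => x ^ 2) μ) (h : ∫ x, x ^ 2 ∂μ = 0) : μ = Measure.dirac 0 := by
  calc μ = μ.map id := Measure.map_id.symm
    _ = μ.map fun _ => 0 := Measure.map_congr ((integral_sq_eq_zero_iff hμ).1 h)
    _ = Measure.dirac 0 := by rw [Measure.map_const, measure_univ, one_smul]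

theorem FiniteMoments.contDiff_charFun [IsFiniteMeasure μ] (hμ : FiniteMoments μ) :
    ContDiff ℝ ∞ (charFun μ) :=
  contDiff_infty.2 fun n => MeasureTheory.contDiff_charFun (hμ.memLp_id n)

theorem FiniteMoments.norm_iteratedDeriv_charFun_le [IsFiniteMeasure μ] (hμ : FiniteMoments μ)
    (n : ℕ) (t : ℝ) : ‖iteratedDeriv n (charFun μ) t‖ ≤ ∫ x, |x| ^ n ∂μ := by
  rw [iteratedDeriv_charFun (hμ.memLp_id n), norm_mul, norm_pow, Complex.norm_I, one_pow, one_mul]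
  refine (norm_integral_le_integral_norm _).trans_eq (integral_congr_ae (.of_forall fun x => ?_))
  have hexp : ‖Complex.exp (t * x * Complex.I)‖ = 1 := by
    rw [← Complex.ofReal_mul, Complex.norm_exp_ofReal_mul_I]
  simp only [norm_mul, hexp, mul_one, norm_pow, Complex.norm_real, Real.norm_eq_abs]

theorem FiniteMoments.iteratedDeriv_charFun_sub [IsFiniteMeasure μ] [IsFiniteMeasure ν]
    (hμ : FiniteMoments μ) (hν : FiniteMoments ν) (n : ℕ) (t : ℝ) :
    iteratedDeriv n (charFun μ - charFun ν) t =
      iteratedDeriv n (charFun μ) t - iteratedDeriv n (charFun ν) t :=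
  iteratedDeriv_sub (MeasureTheory.contDiff_charFun (hμ.memLp_id n)).contDiffAt
    (MeasureTheory.contDiff_charFun (hν.memLp_id n)).contDiffAt

theorem FiniteMoments.norm_iteratedDeriv_charFun_sub_le [IsFiniteMeasure μ] [IsFiniteMeasure ν]
    (hμ : FiniteMoments μ) (hν : FiniteMoments ν) (n : ℕ) (t : ℝ) :
    ‖iteratedDeriv n (charFun μ - charFun ν) t‖ ≤ ∫ x, |x| ^ n ∂(μ + ν) := by
  rw [hμ.iteratedDeriv_charFun_sub hν, hμ.integral_abs_pow_add_measure hν]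
  exact (norm_sub_le _ _).trans (add_le_add (hμ.norm_iteratedDeriv_charFun_le n t)
    (hν.norm_iteratedDeriv_charFun_le n t))

theorem Carleman.eq_of_moments_eq [IsProbabilityMeasure μ] [IsProbabilityMeasure ν]
    (hμ : Carleman μ) (hν : FiniteMoments ν) (hmom : ∀ k : ℕ, ∫ x, x ^ k ∂ν = ∫ x, x ^ k ∂μ) :
    ν = μ := by
  rcases eq_or_ne (∫ x, x ^ 2 ∂μ) 0 with hdeg | hdeg
  · rw [eq_dirac_zero_of_integral_sq_eq_zero (hμ.1 2) hdeg,
      eq_dirac_zero_of_integral_sq_eq_zero (hν 2) ((hmom 2).trans hdeg)]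
  have heven (k : ℕ) : ∫ x, |x| ^ (2 * k) ∂(ν + μ) = 2 * ∫ x, x ^ (2 * k) ∂μ := by
    rw [hν.integral_abs_pow_add_measure hμ.1]
    simp only [(even_two_mul k).pow_abs, hmom]
    exact (two_mul _).symm
  have hM : PosLogConvex fun n => ∫ x, |x| ^ n ∂(ν + μ) := by
    refine (hν.add hμ.1).posLogConvex_integral_abs_pow ?_
    simpa only [mul_one, sq_abs] using (heven 1).trans_ne (mul_ne_zero two_ne_zero hdeg)
  have hratio (k : ℕ) : (∫ x, |x| ^ (2 * k) ∂(ν + μ)) / ∫ x, |x| ^ 0 ∂(ν + μ) =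
      ∫ x, x ^ (2 * k) ∂μ := by
    have hmass : ∫ x, |x| ^ 0 ∂(ν + μ) = 2 := by simpa using heven 0
    rw [heven, hmass, mul_div_cancel_left₀ _ two_ne_zero]
  have hdiv := not_summable_ratio hM.pos (by simpa only [hratio] using hμ.2)
  have hflat (n : ℕ) : iteratedDeriv n (charFun ν - charFun μ) 0 = 0 := by
    rw [hν.iteratedDeriv_charFun_sub hμ.1, iteratedDeriv_charFun_zero (hν.memLp_id n),
      iteratedDeriv_charFun_zero (hμ.1.memLp_id n), hmom, sub_self]
  exact Measure.ext_of_charFun (sub_eq_zero.1 (eq_zero_of_iteratedDeriv_eq_zero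
    (hν.contDiff_charFun.sub hμ.1.contDiff_charFun) hM hdiv
    (hν.norm_iteratedDeriv_charFun_sub_le hμ.1) hflat))

theorem Carleman.mDeterminateOn_univ [IsProbabilityMeasure μ] (hμ : Carleman μ) :
    MDeterminateOn univ μ :=
  ⟨by simp, hμ.1, fun _ _ _ hν hmom => hμ.eq_of_moments_eq hν hmom⟩

end Hamburger

section Stieltjes

variable {μ ν : Measure ℝ}

theorem finiteMoments_of_integrable_even_pow
    (h : ∀ k : ℕ, Integrable (fun x : ℝ => x ^ (2 * k)) μ) : FiniteMoments μ := fun k => by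
  refine ((h 0).add (h k)).mono' (by fun_prop) (.of_forall fun x => ?_)
  calc ‖x ^ k‖ ≤ 1 + ‖x ^ k‖ ^ 2 := by nlinarith [sq_nonneg (‖x ^ k‖ - 1)]
    _ = x ^ (2 * 0) + x ^ (2 * k) := by rw [Real.norm_eq_abs, sq_abs, ← pow_mul']; simp

theorem finiteMoments_map_sq_iff : FiniteMoments (μ.map fun x => x ^ 2) ↔ FiniteMoments μ := by
  have hmap (k : ℕ) : Integrable (fun x : ℝ => x ^ k) (μ.map fun x => x ^ 2) ↔
      Integrable (fun x : ℝ => x ^ (2 * k)) μ := by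
    rw [integrable_map_measure (by fun_prop) (by fun_prop)]
    simp only [Function.comp_def, ← pow_mul]
  exact ⟨fun h => finiteMoments_of_integrable_even_pow fun k => (hmap k).1 (h k),
    fun h k => (hmap k).2 (h (2 * k))⟩

theorem integral_pow_map_sq (μ : Measure ℝ) (k : ℕ) :
    ∫ x, x ^ k ∂(μ.map fun x => x ^ 2) = ∫ x, x ^ (2 * k) ∂μ := by
  rw [integral_map (by fun_prop) (by fun_prop)]
  simp only [← pow_mul]

theorem map_sq_apply_compl_Ici (μ : Measure ℝ) : μ.map (fun x => x ^ 2) (Ici 0)ᶜ = 0 := by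
  rw [Measure.map_apply (by fun_prop) measurableSet_Ici.compl]
  convert measure_empty (μ := μ)
  ext x
  simp [sq_nonneg]

theorem integral_odd_pow_eq_zero [μ.IsNegInvariant] {k : ℕ} (hk : Odd k) :
    ∫ x, x ^ k ∂μ = 0 := by
  have h := integral_neg_eq_self (fun x : ℝ => x ^ k) μ
  simp only [hk.neg_pow, integral_neg] at h
  linarith

/-- The law of `ε * X`, where `X` has law `μ` and `ε` is an independent uniform random sign. -/
noncomputable def symmetrization (μ : Measure ℝ) : Measure ℝ :=
  (2⁻¹ : ℝ≥0∞) • (μ + μ.neg)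

instance (μ : Measure ℝ) : (symmetrization μ).IsNegInvariant where
  neg_eq_self := by
    calc (symmetrization μ).neg = (2⁻¹ : ℝ≥0∞) • (μ.neg + μ.neg.neg) := by
          rw [symmetrization, Measure.neg, Measure.map_smul, Measure.map_add _ _ measurable_neg]
          rfl
      _ = symmetrization μ := by rw [Measure.neg_neg, add_comm, symmetrization]

theorem map_sq_symmetrization (μ : Measure ℝ) :
    (symmetrization μ).map (fun x => x ^ 2) = μ.map fun x => x ^ 2 := by
  have hsq : Measurable fun x : ℝ => x ^ 2 := by fun_prop
  have hneg : μ.neg.map (fun x => x ^ 2) = μ.map fun x => x ^ 2 := by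
    rw [Measure.neg, Measure.map_map hsq measurable_neg]
    simp only [Function.comp_def, neg_sq]
  rw [symmetrization, Measure.map_smul, Measure.map_add _ _ hsq, hneg, ← two_smul ℝ≥0∞, smul_smul,
    ENNReal.inv_mul_cancel two_ne_zero ENNReal.ofNat_ne_top, one_smul]

instance (μ : Measure ℝ) [IsProbabilityMeasure μ] : IsProbabilityMeasure (symmetrization μ) where
  measure_univ := by
    have h := congrArg (· univ) (map_sq_symmetrization μ)
    simpa [Measure.map_apply (f := fun x : ℝ => x ^ 2) (by fun_prop) MeasurableSet.univ] using h

theorem map_sq_map_sqrt (hν : ν (Ici 0)ᶜ = 0) : (ν.map sqrt).map (fun x => x ^ 2) = ν := by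
  have hnonneg : ∀ᵐ x ∂ν, 0 ≤ x := mem_ae_iff.2 hν
  calc (ν.map sqrt).map (fun x => x ^ 2) = ν.map fun x => sqrt x ^ 2 :=
        Measure.map_map (by fun_prop) (by fun_prop)
    _ = ν.map id := Measure.map_congr (hnonneg.mono fun x hx => sq_sqrt hx)
    _ = ν := Measure.map_id

theorem MDeterminateOn.map_sq [μ.IsNegInvariant] (hμ : MDeterminateOn univ μ) :
    MDeterminateOn (Ici 0) (μ.map fun x => x ^ 2) := by
  obtain ⟨-, hfin, huniq⟩ := hμ
  refine ⟨map_sq_apply_compl_Ici μ, finiteMoments_map_sq_iff.2 hfin, fun ν _ hν hνfin hmom => ?_⟩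
  have : IsProbabilityMeasure (ν.map sqrt) := Measure.isProbabilityMeasure_map (by fun_prop)
  set ρ := symmetrization (ν.map sqrt)
  have hρ : ρ.map (fun x => x ^ 2) = ν := (map_sq_symmetrization _).trans (map_sq_map_sqrt hν)
  have hρμ : ρ = μ := by
    refine huniq ρ inferInstance (by simp) (finiteMoments_map_sq_iff.1 (hρ ▸ hνfin)) fun k => ?_
    rcases k.even_or_odd' with ⟨j, rfl | rfl⟩
    · rw [← integral_pow_map_sq, ← integral_pow_map_sq, hρ, hmom]
    · have hodd : Odd (2 * j + 1) := odd_two_mul_add_one j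
      rw [integral_odd_pow_eq_zero hodd, integral_odd_pow_eq_zero hodd]
  rw [← hρμ, hρ]

end Stieltjes

section Symmetric

variable {G : Type*} [MeasurableSpace G] [InvolutiveNeg G] [MeasurableNeg G] {μ : Measure G}
  [μ.IsNegInvariant] {f : G → ℝ≥0∞}

theorem setLIntegral_neg (hf : ∀ x, f (-x) = f x) (s : Set G) :
    ∫⁻ x in -s, f x ∂μ = ∫⁻ x in s, f x ∂μ := by
  have h := (Measure.measurePreserving_neg μ).setLIntegral_comp_preimage_emb
    (MeasurableEquiv.neg G).measurableEmbedding f s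
  simpa only [hf, neg_preimage] using h

theorem isNegInvariant_withDensity (hf : ∀ x, f (-x) = f x) :
    (μ.withDensity f).IsNegInvariant where
  neg_eq_self := by
    ext s hs
    rw [Measure.neg_apply, withDensity_apply _ hs.neg, withDensity_apply _ hs, setLIntegral_neg hf]

end Symmetric

section Tail

variable {μ : Measure ℝ} {a : ℝ}

theorem setLIntegral_le_abs_le [μ.IsNegInvariant] {φ : ℝ → ℝ≥0∞} (hφ : ∀ x, φ (-x) = φ x)
    (a : ℝ) : ∫⁻ x in {x | a ≤ |x|}, φ x ∂μ ≤ 2 * ∫⁻ x in Ici a, φ x ∂μ := by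
  have hset : {x : ℝ | a ≤ |x|} = Ici a ∪ -Ici a := by
    ext x
    simp [le_abs, le_neg]
  calc ∫⁻ x in {x | a ≤ |x|}, φ x ∂μ
      ≤ ∫⁻ x in Ici a, φ x ∂μ + ∫⁻ x in -Ici a, φ x ∂μ := hset ▸ lintegral_union_le _ _ _
    _ = 2 * ∫⁻ x in Ici a, φ x ∂μ := by rw [setLIntegral_neg hφ, two_mul]

theorem setLIntegral_Ici_eq_top [μ.IsNegInvariant] {φ : ℝ → ℝ≥0∞} (hφ : ∀ x, φ (-x) = φ x)
    (h : ∫⁻ x in {x | a ≤ |x|}, φ x ∂μ = ∞) : ∫⁻ x in Ici a, φ x ∂μ = ∞ := by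
  have hle := setLIntegral_le_abs_le (μ := μ) hφ a
  rw [h, top_le_iff, ENNReal.mul_eq_top] at hle
  simpa using hle

theorem lintegral_even_pow_le [IsProbabilityMeasure μ] [μ.IsNegInvariant] (ha : 1 ≤ a) {n : ℕ}
    (htail : ∫⁻ x in Ici a, ENNReal.ofReal (x ^ (2 * n)) ∂μ ≤ 1) :
    ∫⁻ x, ENNReal.ofReal (x ^ (2 * n)) ∂μ ≤ ENNReal.ofReal (3 * a ^ (2 * n)) := by
  have hs : MeasurableSet {x : ℝ | a ≤ |x|} := measurableSet_le measurable_const (by fun_prop)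
  have hfar : ∫⁻ x in {x | a ≤ |x|}, ENNReal.ofReal (x ^ (2 * n)) ∂μ ≤ 2 :=
    calc _ ≤ 2 * ∫⁻ x in Ici a, ENNReal.ofReal (x ^ (2 * n)) ∂μ :=
          setLIntegral_le_abs_le (fun x => by rw [(even_two_mul n).neg_pow]) a
      _ ≤ 2 := mul_le_of_le_one_right' htail
  have hnear : ∫⁻ x in {x | a ≤ |x|}ᶜ, ENNReal.ofReal (x ^ (2 * n)) ∂μ ≤
      ENNReal.ofReal (a ^ (2 * n)) :=
    calc _ ≤ ∫⁻ _ in {x | a ≤ |x|}ᶜ, ENNReal.ofReal (a ^ (2 * n)) ∂μ := by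
          refine setLIntegral_mono' hs.compl fun x hx => ENNReal.ofReal_le_ofReal ?_
          rw [← (even_two_mul n).pow_abs x]
          exact pow_le_pow_left₀ (abs_nonneg x) (le_of_not_ge hx) _
      _ = ENNReal.ofReal (a ^ (2 * n)) * μ {x | a ≤ |x|}ᶜ := setLIntegral_const _ _
      _ ≤ ENNReal.ofReal (a ^ (2 * n)) := mul_le_of_le_one_right' prob_le_one
  have hpow : 1 ≤ a ^ (2 * n) := one_le_pow₀ ha
  calc ∫⁻ x, ENNReal.ofReal (x ^ (2 * n)) ∂μ ≤ 2 + ENNReal.ofReal (a ^ (2 * n)) :=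
        (lintegral_add_compl _ hs).symm.trans_le (add_le_add hfar hnear)
    _ = ENNReal.ofReal (2 + a ^ (2 * n)) := by
        rw [ENNReal.ofReal_add zero_le_two (by positivity), ENNReal.ofReal_ofNat]
    _ ≤ ENNReal.ofReal (3 * a ^ (2 * n)) := ENNReal.ofReal_le_ofReal (by linarith)

theorem restrict_le_withDensity_mono {α : Type*} [MeasurableSpace α] {μ ν : Measure α}
    {f g : α → ℝ≥0∞} {s t : Set α} (hs : MeasurableSet s) (hst : s ⊆ t)
    (hμ : μ.restrict t ≤ ν.withDensity f) (hfg : f ≤ᵐ[ν.restrict s] g) :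
    μ.restrict s ≤ (ν.restrict s).withDensity g :=
  calc μ.restrict s = (μ.restrict t).restrict s := (Measure.restrict_restrict_of_subset hst).symm
    _ ≤ (ν.withDensity f).restrict s := Measure.restrict_mono_measure hμ s
    _ = (ν.restrict s).withDensity f := restrict_withDensity hs f
    _ ≤ (ν.restrict s).withDensity g := withDensity_mono hfg

/-- The measure `x⁻² dx` on the line. -/
noncomputable def invSqMeasure : Measure ℝ :=
  volume.withDensity fun x => ENNReal.ofReal (x ^ 2)⁻¹

theorem setLIntegral_invSqMeasure (φ : ℝ → ℝ≥0∞) {s : Set ℝ} (hs : MeasurableSet s) :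
    ∫⁻ x in s, φ x ∂invSqMeasure = ∫⁻ x in s, ENNReal.ofReal (x ^ 2)⁻¹ * φ x :=
  setLIntegral_withDensity_eq_setLIntegral_mul_non_measurable volume
    (f := fun x => ENNReal.ofReal (x ^ 2)⁻¹) (by fun_prop) _ hs
    (.of_forall fun _ => ENNReal.ofReal_lt_top)

theorem invSqMeasure_Ici (ha : 0 < a) : invSqMeasure (Ici a) = ENNReal.ofReal a⁻¹ := by
  have hrpow : EqOn (fun x : ℝ => (x ^ 2)⁻¹) (fun x => x ^ (-2 : ℝ)) (Ioi a) := fun x hx => by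
    simp only [rpow_neg (ha.trans hx).le, rpow_two]
  rw [invSqMeasure, withDensity_apply _ measurableSet_Ici, ← setLIntegral_congr Ioi_ae_eq_Ici,
    ← ofReal_integral_eq_lintegral_ofReal _ (.of_forall fun x => by positivity),
    setIntegral_congr_fun measurableSet_Ioi hrpow, integral_Ioi_rpow_of_lt (by norm_num) ha]
  · norm_num [rpow_neg_one]
  · exact (integrableOn_Ioi_rpow_of_lt (by norm_num) ha).congr_fun hrpow.symm measurableSet_Ioi

theorem setLIntegral_even_pow_le_one (ha : 1 ≤ a) {n : ℕ} (hμ : μ.restrict (Ici a) ≤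
      (volume.restrict (Ici a)).withDensity fun x => ENNReal.ofReal (x ^ (2 * n + 2))⁻¹) :
    ∫⁻ x in Ici a, ENNReal.ofReal (x ^ (2 * n)) ∂μ ≤ 1 :=
  calc ∫⁻ x in Ici a, ENNReal.ofReal (x ^ (2 * n)) ∂μ
      ≤ ∫⁻ x in Ici a, ENNReal.ofReal (x ^ (2 * n + 2))⁻¹ * ENNReal.ofReal (x ^ (2 * n)) := by
        refine (lintegral_mono' hμ le_rfl).trans_eq ?_
        exact lintegral_withDensity_eq_lintegral_mul _ (by fun_prop) (by fun_prop)
    _ = ∫⁻ x in Ici a, ENNReal.ofReal (x ^ 2)⁻¹ := by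
        refine setLIntegral_congr_fun measurableSet_Ici fun x hx => ?_
        have hx : 0 < x := by linarith [mem_Ici.1 hx]
        rw [← ENNReal.ofReal_mul (by positivity), pow_add, mul_inv_rev,
          inv_mul_cancel_right₀ (by positivity)]
    _ = invSqMeasure (Ici a) := (withDensity_apply _ measurableSet_Ici).symm
    _ ≤ 1 := by
        rw [invSqMeasure_Ici (by linarith)]
        exact ENNReal.ofReal_le_one.2 (inv_le_one_of_one_le₀ ha)

theorem le_inv_pow_of_le_neg_log_div_log {x y : ℝ} (hx : 1 < x) (hy : 0 < y) {m : ℕ}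
    (h : m ≤ -log y / log x) : y ≤ (x ^ m)⁻¹ := by
  have hxm : 0 < x ^ m := pow_pos (by linarith) m
  rw [le_div_iff₀ (log_pos hx)] at h
  rw [← log_le_log_iff hy (inv_pos.2 hxm), log_inv, log_pow]
  linarith

end Tail

section Thresholds

variable {α : Type*} [MeasurableSpace α] {κ : Measure α} {g : α → ℝ}

theorem ofReal_le_tsum_ite (y : ℝ) :
    ENNReal.ofReal y ≤ ∑' k : ℕ, if (k : ℝ) ≤ y then 1 else 0 := by
  rcases lt_or_ge y 0 with hy | hy
  · simp [ENNReal.ofReal_of_nonpos hy.le]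
  calc ENNReal.ofReal y ≤ (⌊y⌋₊ + 1 : ℕ) :=
        (ENNReal.ofReal_le_natCast).2 (mod_cast (Nat.lt_floor_add_one y).le)
    _ = ∑ k ∈ range (⌊y⌋₊ + 1), if (k : ℝ) ≤ y then (1 : ℝ≥0∞) else 0 := by
        rw [Finset.sum_congr rfl fun k hk => if_pos <| (Nat.le_floor_iff hy).1 <|
          Nat.le_of_lt_succ (Finset.mem_range.1 hk)]
        simp
    _ ≤ ∑' k : ℕ, if (k : ℝ) ≤ y then 1 else 0 := ENNReal.sum_le_tsum _

theorem lintegral_ofReal_le_tsum_measure {s : ℕ → Set α} (hs : ∀ k, MeasurableSet (s k))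
    (hgs : ∀ᵐ x ∂κ, ∀ k : ℕ, (k : ℝ) ≤ g x → x ∈ s k) :
    ∫⁻ x, ENNReal.ofReal (g x) ∂κ ≤ ∑' k, κ (s k) :=
  calc ∫⁻ x, ENNReal.ofReal (g x) ∂κ ≤ ∫⁻ x, ∑' k, (s k).indicator 1 x ∂κ := by
        refine lintegral_mono_ae (hgs.mono fun x hx => (ofReal_le_tsum_ite (g x)).trans ?_)
        refine ENNReal.tsum_le_tsum fun k => ?_
        split_ifs with hk
        · rw [indicator_of_mem (hx k hk), Pi.one_apply]
        · exact zero_le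
    _ = ∑' k, κ (s k) := by
        rw [lintegral_tsum fun k => (measurable_one.indicator (hs k)).aemeasurable]
        simp only [lintegral_indicator_one (hs _)]

theorem lintegral_ofReal_sub_div_eq_top [IsFiniteMeasure κ]
    (hg : ∫⁻ x, ENNReal.ofReal (g x) ∂κ = ∞) (c : ℝ) {s : ℝ} (hs : 0 < s) :
    ∫⁻ x, ENNReal.ofReal ((g x - c) / s) ∂κ = ∞ := by
  by_contra hfin
  have hconst : ∫⁻ _, ENNReal.ofReal c ∂κ ≠ ∞ := by
    simpa using ENNReal.mul_ne_top ENNReal.ofReal_ne_top (measure_ne_top κ _)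
  refine absurd hg (ne_top_of_le_ne_top (ENNReal.add_ne_top.2
    ⟨hconst, ENNReal.mul_ne_top (ENNReal.ofReal_ne_top (r := s)) hfin⟩) ?_)
  rw [← lintegral_const_mul' _ _ ENNReal.ofReal_ne_top, ← lintegral_add_left measurable_const]
  refine lintegral_mono fun x => ?_
  calc ENNReal.ofReal (g x) = ENNReal.ofReal (c + s * ((g x - c) / s)) := by
        rw [mul_div_cancel₀ _ hs.ne', add_sub_cancel]
    _ ≤ ENNReal.ofReal c + ENNReal.ofReal (s * ((g x - c) / s)) := ENNReal.ofReal_add_le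
    _ = _ := by rw [ENNReal.ofReal_mul hs.le]

theorem exists_mem_le_of_lintegral_ofReal_eq_top {s : Set α} (hs : κ s ≠ ∞)
    (hg : ∫⁻ x in s, ENNReal.ofReal (g x) ∂κ = ∞) (c : ℝ) : ∃ x ∈ s, c ≤ g x := by
  by_contra! hlt
  refine absurd hg (ne_top_of_le_ne_top
    (ENNReal.mul_ne_top (ENNReal.ofReal_ne_top (r := c)) hs) ?_)
  exact (setLIntegral_mono measurable_const fun x hx =>
    ENNReal.ofReal_le_ofReal (hlt x hx).le).trans_eq (setLIntegral_const s (ENNReal.ofReal c))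

variable {H : ℝ → ℝ} {x₀ : ℝ}

theorem exists_threshold (hH : MonotoneOn H (Ici x₀)) {c : ℝ} (hc : ∃ x ∈ Ici x₀, c ≤ H x) :
    ∃ b, x₀ ≤ b ∧ (∀ x, b < x → c ≤ H x) ∧ ∀ x ∈ Ici x₀, c ≤ H x → b ≤ x := by
  have hbdd : BddBelow {x | x ∈ Ici x₀ ∧ c ≤ H x} := ⟨x₀, fun x hx => hx.1⟩
  refine ⟨sInf {x | x ∈ Ici x₀ ∧ c ≤ H x}, le_csInf hc fun x hx => hx.1, fun x hx => ?_,
    fun x hx hcx => csInf_le hbdd ⟨hx, hcx⟩⟩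
  obtain ⟨y, ⟨hy, hcy⟩, hyx⟩ := exists_lt_of_csInf_lt hc hx
  exact hcy.trans (hH hy (hy.trans hyx.le) hyx.le)

theorem exists_thresholds (hx₀ : 0 < x₀) (hmono : MonotoneOn H (Ici x₀))
    (hH : ∫⁻ x in Ici x₀, ENNReal.ofReal (H x) ∂invSqMeasure = ∞) :
    ∃ b : ℕ → ℝ, (∀ n, x₀ ≤ b n) ∧ (∀ n : ℕ, ∀ x, b n < x → 2 * (n : ℝ) + 2 ≤ H x) ∧
      ∑' k, ENNReal.ofReal (b (k + 1))⁻¹ = ∞ := by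
  have hfinite : invSqMeasure (Ici x₀) ≠ ∞ := by
    rw [invSqMeasure_Ici hx₀]
    exact ENNReal.ofReal_ne_top
  have : IsFiniteMeasure (invSqMeasure.restrict (Ici x₀)) := isFiniteMeasure_restrict.2 hfinite
  choose b hx₀b hb hb_le using fun n : ℕ => exists_threshold hmono
    (exists_mem_le_of_lintegral_ofReal_eq_top hfinite hH (2 * n + 2))
  refine ⟨b, hx₀b, hb, top_le_iff.1 ?_⟩
  calc ∞ = ∫⁻ x in Ici x₀, ENNReal.ofReal ((H x - 4) / 2) ∂invSqMeasure :=
        (lintegral_ofReal_sub_div_eq_top hH 4 two_pos).symm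
    _ ≤ ∑' k, invSqMeasure.restrict (Ici x₀) (Ici (b (k + 1))) := by
        refine lintegral_ofReal_le_tsum_measure (fun _ => measurableSet_Ici)
          (ae_restrict_of_forall_mem measurableSet_Ici fun x hx k hk => hb_le _ x hx ?_)
        push_cast
        linarith
    _ ≤ ∑' k, ENNReal.ofReal (b (k + 1))⁻¹ := by
        refine ENNReal.tsum_le_tsum fun k => (Measure.restrict_apply_le _ _).trans_eq ?_
        exact invSqMeasure_Ici (hx₀.trans_le (hx₀b _))

end Thresholds

section TailCriterion

variable {μ : Measure ℝ}

theorem ofReal_inv_le_ofReal_rpow {m b : ℝ} (hb : 0 < b) {k : ℕ} (hm : m ≤ b ^ (2 * (k + 1))) :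
    ENNReal.ofReal b⁻¹ ≤ ENNReal.ofReal m ^ (-1 / (2 * ((k : ℝ) + 1))) := by
  have hpow : ENNReal.ofReal (b ^ (2 * (k + 1))) ^ (1 / (2 * ((k : ℝ) + 1))) =
      ENNReal.ofReal b := by
    rw [ENNReal.ofReal_rpow_of_pos (by positivity), ← rpow_natCast_mul hb.le]
    push_cast
    rw [mul_one_div_cancel (by positivity), rpow_one]
  rw [ENNReal.ofReal_inv_of_pos hb, neg_div, ENNReal.rpow_neg, ENNReal.inv_le_inv, ← hpow]
  exact ENNReal.rpow_le_rpow (ENNReal.ofReal_le_ofReal hm) (by positivity)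

theorem finiteMoments_of_lintegral_even_pow_ne_top
    (h : ∀ n : ℕ, ∫⁻ x, ENNReal.ofReal (x ^ (2 * n)) ∂μ ≠ ∞) : FiniteMoments μ :=
  finiteMoments_of_integrable_even_pow fun n => (lintegral_ofReal_ne_top_iff_integrable
    (by fun_prop) (.of_forall fun x => (even_two_mul n).pow_nonneg x)).1 (h n)

theorem carleman_of_lintegral_even_pow_le {b : ℕ → ℝ} (hb : ∀ n, 0 < b n)
    (hdiv : ∑' k, ENNReal.ofReal (b (k + 1))⁻¹ = ∞) {C : ℝ} (hC : 1 ≤ C)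
    (hmom : ∀ n, ∫⁻ x, ENNReal.ofReal (x ^ (2 * n)) ∂μ ≤ ENNReal.ofReal (C * b n ^ (2 * n))) :
    Carleman μ := by
  have hfin : FiniteMoments μ := finiteMoments_of_lintegral_even_pow_ne_top fun n =>
    ne_top_of_le_ne_top ENNReal.ofReal_ne_top (hmom n)
  have hCpos : 0 < C := by linarith
  have hpow (k : ℕ) : ∫ x, x ^ (2 * (k + 1)) ∂μ ≤ (C * b (k + 1)) ^ (2 * (k + 1)) := by
    have hbk := hb (k + 1)
    calc ∫ x, x ^ (2 * (k + 1)) ∂μ ≤ C * b (k + 1) ^ (2 * (k + 1)) := by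
          rw [← ENNReal.ofReal_le_ofReal_iff (by positivity), ofReal_integral_eq_lintegral_ofReal
            (hfin _) (.of_forall fun x => (even_two_mul (k + 1)).pow_nonneg x)]
          exact hmom (k + 1)
      _ ≤ C ^ (2 * (k + 1)) * b (k + 1) ^ (2 * (k + 1)) := by
          gcongr
          exact le_self_pow₀ hC (by lia)
      _ = (C * b (k + 1)) ^ (2 * (k + 1)) := (mul_pow _ _ _).symm
  refine ⟨hfin, top_le_iff.1 ?_⟩
  calc ∞ = ENNReal.ofReal C⁻¹ * ∑' k, ENNReal.ofReal (b (k + 1))⁻¹ := by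
        rw [hdiv, ENNReal.mul_top (by simpa using hCpos)]
    _ = ∑' k, ENNReal.ofReal (C * b (k + 1))⁻¹ := by
        rw [← ENNReal.tsum_mul_left]
        simp only [mul_inv, ENNReal.ofReal_mul (inv_nonneg.2 hCpos.le)]
    _ ≤ _ := ENNReal.tsum_le_tsum fun k =>
        ofReal_inv_le_ofReal_rpow (mul_pos hCpos (hb _)) (hpow k)

theorem carleman_of_tail_le [IsProbabilityMeasure μ] [μ.IsNegInvariant] {f : ℝ → ℝ} {x₀ : ℝ}
    (hx₀ : 1 < x₀)
    (hμ : μ.restrict (Ici x₀) ≤ volume.withDensity fun x => ENNReal.ofReal (f x))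
    (hf_pos : ∀ x, x₀ ≤ x → 0 < f x)
    (hK : ∫⁻ x in Ici x₀, ENNReal.ofReal (-log (f x) / (x ^ 2 * log x)) = ∞)
    (hmono : MonotoneOn (fun x => -log (f x) / log x) (Ici x₀)) : Carleman μ := by
  have hH : ∫⁻ x in Ici x₀, ENNReal.ofReal (-log (f x) / log x) ∂invSqMeasure = ∞ := by
    rw [setLIntegral_invSqMeasure _ measurableSet_Ici, ← hK]
    refine lintegral_congr fun x => ?_
    rw [← ENNReal.ofReal_mul (by positivity), ← div_eq_inv_mul, div_div, mul_comm]
  obtain ⟨b, hb, hdecay, hdiv⟩ := exists_thresholds (by linarith) hmono hH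
  refine carleman_of_lintegral_even_pow_le (fun n => by linarith [hb n]) hdiv
    (C := 3) (by norm_num) fun n => ?_
  have hb1 : 1 ≤ b n := by linarith [hb n]
  have hf_le (x : ℝ) (hx : b n < x) : f x ≤ (x ^ (2 * n + 2))⁻¹ := by
    have hxx₀ : x₀ < x := (hb n).trans_lt hx
    exact le_inv_pow_of_le_neg_log_div_log (hx₀.trans hxx₀) (hf_pos x hxx₀.le)
      (by simpa using hdecay n x hx)
  refine lintegral_even_pow_le hb1 (setLIntegral_even_pow_le_one hb1 ?_)
  refine restrict_le_withDensity_mono measurableSet_Ici (Ici_subset_Ici.2 (hb n)) hμ ?_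
  rw [← Measure.restrict_congr_set Ioi_ae_eq_Ici]
  exact ae_restrict_of_forall_mem measurableSet_Ioi fun x hx =>
    ENNReal.ofReal_le_ofReal (hf_le x hx)

end TailCriterion

end MomentProblem

theorem theorem1_general {Ω : Type*} [MeasurableSpace Ω] {P : Measure Ω} [IsProbabilityMeasure P]
    {X : Ω → ℝ} (hX : AEMeasurable X P) [(P.map X).IsNegInvariant] {f : ℝ → ℝ} {x₀ : ℝ}
    (hx₀ : 1 < x₀)
    (hf_tail : (P.map X).restrict (Set.Ici x₀) ≤
      volume.withDensity fun x => ENNReal.ofReal (f x))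
    (hf_pos : ∀ x, x₀ ≤ x → 0 < f x)
    (hK : ∫⁻ x in Set.Ici x₀, ENNReal.ofReal (-Real.log (f x) / (x ^ 2 * Real.log x)) = ∞)
    (hmono : MonotoneOn (fun x => -Real.log (f x) / Real.log x) (Set.Ici x₀)) :
    MomentProblem.Carleman (P.map X) ∧ MomentProblem.MDeterminateOn Set.univ (P.map X) ∧
      MomentProblem.MDeterminateOn (Set.Ici 0) (P.map fun ω => X ω ^ 2) := by
  have : IsProbabilityMeasure (P.map X) := Measure.isProbabilityMeasure_map hX
  have hC := MomentProblem.carleman_of_tail_le hx₀ hf_tail hf_pos hK hmono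
  have hsq : P.map (fun ω => X ω ^ 2) = (P.map X).map fun x => x ^ 2 :=
    (AEMeasurable.map_map_of_aemeasurable (g := fun x : ℝ => x ^ 2) (by fun_prop) hX).symm
  exact ⟨hC, hC.mDeterminateOn_univ, hsq ▸ hC.mDeterminateOn_univ.map_sq⟩

theorem theorem1 {Ω : Type*} [MeasurableSpace Ω] (P : Measure Ω) [IsProbabilityMeasure P]
    (X : Ω → ℝ) (hX : AEMeasurable X P)
    (f : ℝ → ℝ) (hf_meas : Measurable f) (hf_nonneg : ∀ x, 0 ≤ f x)
    (hf_density : P.map X = volume.withDensity (fun x => ENNReal.ofReal (f x)))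
    (hf_symm : ∀ x, f (-x) = f x)
    (x₀ : ℝ) (hx₀ : 1 < x₀)
    (hf_cont : ContinuousOn f {x : ℝ | x₀ ≤ |x|})
    (hf_pos : ∀ x : ℝ, x₀ ≤ |x| → 0 < f x)
    (hK : MomentProblem.IntegralEqTop
      (fun x => -Real.log (f x) / (x ^ 2 * Real.log |x|)) {x : ℝ | x₀ ≤ |x|})
    (hmono : MonotoneOn (fun x => -Real.log (f x) / Real.log x) (Set.Ici x₀))
    (hlim : Filter.Tendsto (fun x => -Real.log (f x) / Real.log x) Filter.atTop Filter.atTop) :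
    MomentProblem.Carleman (P.map X) ∧
      MomentProblem.MDeterminateOn Set.univ (P.map X) ∧
      MomentProblem.MDeterminateOn (Set.Ici 0) (P.map (fun ω => X ω ^ 2)) := by
  have : (P.map X).IsNegInvariant :=
    hf_density ▸ MomentProblem.isNegInvariant_withDensity fun x => by rw [hf_symm]
  have hK_right := MomentProblem.setLIntegral_Ici_eq_top (by simp [hf_symm]) hK.1
  exact theorem1_general hX hx₀ (hf_density ▸ Measure.restrict_le_self)
    (fun x hx => hf_pos x (hx.trans (le_abs_self x))) (by simpa using hK_right) hmono
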